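/- For $N\ge1$ let $\langle\cdot\rangle$ be the average over the Laguerre ensemble, i.e. over $y\in[0,\infty)^N$ with density proportional to $e^{-N\sum_i y_i}\prod_{i<j}(y_i-y_j)^2$, and write $\langle\mathrm{tr}\,H^m\rangle=\langle\sum_i y_i^m\rangle$. The one-loop mean $W_1(x)=\langle\mathrm{tr}\,(x-H)^{-1}\rangle$ is understood as the generating series $\sum_{m\ge0}\langle\mathrm{tr}\,H^m\rangle x^{-m-1}$. Its genus expansion is $W_1=\sum_{g\ge0}N^{1-2g}W_1^{(g)}$: there are numbers $c_m^{(g)}$ (the coefficients of the large-$N$ expansion of the moments), vanishing for $m<2g$, with $\langle\mathrm{tr}\,H^m\rangle=\sum_{0\le g\le m/2}N^{1-2g}c_m^{(g)}$ for all $N\ge1$, $m\ge0$, and $$W_1^{(g)}(x)=\sum_{m\ge0}c_m^{(g)}x^{-m-1},$$ a series that converges for $|x|>4$. Set $x=e^\lambda+e^{-\lambda}+2$ with $\operatorname{Re}\lambda>0$, write $W_1^{(g)}(\lambda)$ for $W_1^{(g)}(x)$, and put $v_k(\lambda)=\left(\frac{e^\lambda-1}{e^\lambda+1}\right)^{2k+1}$,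 $k\in\mathbb Z$. Then $W_1^{(g)}(\lambda)\to0$ as $\lambda\to+\infty$ along the reals, and there is a unique family of real numbers $a_k^{(g)}$ ($g\ge0$, $k\in\mathbb Z$, with $a_k^{(g)}=0$ unless $-3g\le k\le g$) such that for all $\lambda$ with $\operatorname{Re}\lambda>0$ and $|x|>4$ $$W_1^{(g)}(\lambda)=\frac{\delta_{g,0}}2+\sum_{k=-3g}^{g}a_k^{(g)}v_k(\lambda).$$ These coefficients are also the unique family, with $a_k^{(g)}=0$ unless $-3g\le k\le g$, such that $a_k^{(0)}=-\delta_{k,0}/2$; for all $g\ge1$ and all $k\ne0$ $$\begin{aligned}4k\,a_k^{(g)}={}&\frac{(2k+7)(2k+5)(2k+3)}{32}a_{k+3}^{(g-1)}-\frac{(2k+5)(2k+3)(k+1)}{4}a_{k+2}^{(g-1)}+\frac{3(2k+3)(2k+1)^2}{16}a_{k+1}^{(g-1)}\\&-\frac{(2k+1)k(2k-1)}{4}a_k^{(g-1)}+\frac{(2k-1)^2(2k-3)}{32}a_{k-1}^{(g-1)};\end{aligned}$$ and, for all $g\ge1$, $$\sum_{k=-3g}^{g}a_k^{(g)}=0.$$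 -/

import Mathlib

open MeasureTheory Filter Topology

noncomputable section

/-- The unnormalised eigenvalue density `e^{-N ∑ yᵢ} Δ(y)²` of the `N × N` Laguerre ensemble,
where `Δ(y) = ∏_{i<j} (yᵢ - yⱼ)`. -/
def laguerreWeight (N : ℕ) (y : Fin N → ℝ) : ℝ :=
  Real.exp (-(N : ℝ) * ∑ i, y i) * (∏ i, ∏ j ∈ Finset.Ioi i, (y i - y j)) ^ 2

/-- The partition function: the integral of the density over `[0,∞)^N`. -/
def laguerreZ (N : ℕ) : ℝ :=
  ∫ y in {y : Fin N → ℝ | ∀ i, 0 ≤ y i}, laguerreWeight N y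

/-- The mean `⟨tr f(H)⟩` of `tr f(H) = ∑ᵢ f(yᵢ)` in the Laguerre ensemble. -/
def laguerreTraceMean (N : ℕ) (f : ℝ → ℝ) : ℝ :=
  (1 / laguerreZ N) *
    ∫ y in {y : Fin N → ℝ | ∀ i, 0 ≤ y i}, laguerreWeight N y * ∑ i, f (y i)

/-- The moment `⟨tr H^m⟩`. The one-loop mean `W₁(x) = ⟨tr (x - H)⁻¹⟩` is the generating function
`∑_{m ≥ 0} ⟨tr H^m⟩ x^{-m-1}` of these moments. -/
def laguerreMoment (N m : ℕ) : ℝ :=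
  laguerreTraceMean N (fun t => t ^ m)

/-- The coefficient of `N^{1-2g}` in the large-`N` expansion of `⟨tr H^m⟩`, that is
`lim_{N → ∞} N^{2g-1} (⟨tr H^m⟩ - ∑_{h<g} N^{1-2h} c_h)`, where `c_h` are the previous
coefficients. -/
def genusCoeff (m : ℕ) (g : ℕ) : ℝ :=
  limUnder atTop (fun N : ℕ =>
    (N : ℝ) ^ (2 * (g : ℤ) - 1) *
      (laguerreMoment N m - ∑ h : Fin g, (N : ℝ) ^ (1 - 2 * ((h : ℕ) : ℤ)) * genusCoeff m h))
termination_by g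
decreasing_by exact h.2

/-- The terms of the series in `1/x` of the genus-`g` part of the one-loop mean. -/
def genusMeanTerm (g : ℕ) (x : ℂ) (m : ℕ) : ℂ :=
  (genusCoeff m g : ℂ) / x ^ (m + 1)

/-- The genus-`g` term `W₁^{(g)}(x)` of `W₁(x) = ∑_g N^{1-2g} W₁^{(g)}(x)`. -/
def genusMean (g : ℕ) (x : ℂ) : ℂ :=
  ∑' m : ℕ, genusMeanTerm g x m

/-- The change of variables `x = e^l + e^{-l} + 2`. -/
def spectralX (l : ℂ) : ℂ :=
  Complex.exp l + Complex.exp (-l) + 2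

/-- `v_k(l) = ((e^l - 1) / (e^l + 1))^{2k+1}`, for `k ∈ ℤ`. -/
def vFun (k : ℤ) (l : ℂ) : ℂ :=
  ((Complex.exp l - 1) / (Complex.exp l + 1)) ^ (2 * k + 1)

/-- `a g k` vanishes outside `-3g ≤ k ≤ g`. -/
def GenusSupported (a : ℕ → ℤ → ℝ) : Prop :=
  ∀ (g : ℕ) (k : ℤ), k < -3 * (g : ℤ) ∨ (g : ℤ) < k → a g k = 0

/-- The numbers `a g k`, `-3g ≤ k ≤ g`, are the coefficients of an expansion of all `W₁^{(g)}` in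
the functions `v_k`; in genus zero there is an additional constant `1/2`. The variable `l` ranges
over all values in the sheet `Re l > 0` at which the series in `1/x` is required to converge,
`|x| > 4`. -/
def IsVExpansion (a : ℕ → ℤ → ℝ) : Prop :=
  GenusSupported a ∧
  ∀ (g : ℕ) (l : ℂ), 0 < l.re → 4 < ‖spectralX l‖ →
    genusMean g (spectralX l) =
      (if g = 0 then 1 / 2 else 0) +
        ∑ k ∈ Finset.Icc (-3 * (g : ℤ)) (g : ℤ), (a g k : ℂ) * vFun k l

/-- The recursive determination of the coefficients: initial values, the five-term recursion at
`k ≠ 0`, and the vanishing of the sum of the coefficients in positive genus. -/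
def SatisfiesVRecursion (a : ℕ → ℤ → ℝ) : Prop :=
  GenusSupported a ∧
  (∀ k : ℤ, a 0 k = if k = 0 then -1 / 2 else 0) ∧
  (∀ (g : ℕ) (k : ℤ), 0 < g → k ≠ 0 →
    4 * (k : ℝ) * a g k =
      (2 * (k : ℝ) + 7) * (2 * k + 5) * (2 * k + 3) / 32 * a (g - 1) (k + 3)
      - (2 * (k : ℝ) + 5) * (2 * k + 3) * (k + 1) / 4 * a (g - 1) (k + 2)
      + 3 * (2 * (k : ℝ) + 3) * (2 * k + 1) ^ 2 / 16 * a (g - 1) (k + 1)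
      - (2 * (k : ℝ) + 1) * k * (2 * k - 1) / 4 * a (g - 1) k
      + (2 * (k : ℝ) - 1) ^ 2 * (2 * k - 3) / 32 * a (g - 1) (k - 1)) ∧
  (∀ g : ℕ, 0 < g → ∑ k ∈ Finset.Icc (-3 * (g : ℤ)) (g : ℤ), a g k = 0)

end

/-!
After rescaling by `N`, the Vandermonde determinant in the density is, up to a constant, the
determinant of the Laguerre polynomials, which are orthonormal for `e^{-x}`. Andréief's identity
therefore expresses `⟨tr H^m⟩` through the integral of `x^m e^{-x}` against `∑_{k < N} L_k²`, and
the first-order system satisfied by this kernel, by `L_N L_{N-1}` and by `L_N² - L_{N-1}²` yields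
the Haagerup–Thorbjørnsen three-term recursion in `m`. Its only dependence on `N` is a factor
`N⁻²`, so the moments are polynomial in `N⁻²` up to a factor `N`, and the genus coefficients obey a
recursion of their own.

On the other side, `1 - 4 / x = ((e^l - 1) / (e^l + 1))²`, so that `v_k = (1 - 4 / x)^{k + 1/2}` is
a binomial series in `1 / x`. Transposing the five-term recursion for `a_k` turns it into the genus
recursion for the coefficients of `∑ a_k v_k`, provided that it also holds at `k = 0`. It does,
because its two sides, multiplication by `4k` and the five-term operator, are both skew for the
symmetric form `∑ (4k² - 1) a_k b_{-k}`. Uniqueness of the expansion is the linear independence of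
the powers `w^{2k+1}` on `(0, 1)`.
-/

/-! ### Laguerre polynomials -/

section GammaFunctional

open Polynomial

section Semiring

variable {R : Type*} [CommSemiring R]

/-- The linear functional `X ^ k ↦ (p + k)!` on polynomials. Over the reals it is integration
against `x ^ p * exp (-x)` on `[0, ∞)`; here it is defined algebraically, over any coefficients. -/
def gammaFunctional (p : ℕ) : R[X] →ₗ[R] R :=
  Polynomial.lsum fun k => ((p + k).factorial : R) • LinearMap.id

theorem gammaFunctional_monomial (p k : ℕ) (a : R) :
    gammaFunctional p (monomial k a) = (p + k).factorial * a := by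
  simp [gammaFunctional, Polynomial.lsum_apply, Polynomial.sum_monomial_index]

theorem gammaFunctional_X_mul (p : ℕ) (q : R[X]) :
    gammaFunctional p (X * q) = gammaFunctional (p + 1) q := by
  induction q using Polynomial.induction_on' with
  | add q r hq hr => rw [mul_add, map_add, map_add, hq, hr]
  | monomial k a =>
    rw [X_mul_monomial, gammaFunctional_monomial, gammaFunctional_monomial, add_right_comm,
      add_assoc]

theorem gammaFunctional_X_pow_mul (p m : ℕ) (q : R[X]) :
    gammaFunctional p (X ^ m * q) = gammaFunctional (p + m) q := by
  induction m generalizing p with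
  | zero => rw [pow_zero, one_mul, add_zero]
  | succ m ih => rw [pow_succ', mul_assoc, gammaFunctional_X_mul, ih, add_right_comm, add_assoc]

end Semiring

variable {R : Type*} [CommRing R]

theorem gammaFunctional_zero_derivative (q : R[X]) :
    gammaFunctional 0 (derivative q) = gammaFunctional 0 q - q.coeff 0 := by
  induction q using Polynomial.induction_on' with
  | add q r hq hr => simp only [map_add, hq, hr, coeff_add]; ring
  | monomial k a =>
    rw [derivative_monomial, gammaFunctional_monomial, gammaFunctional_monomial]
    cases k with
    | zero => simp
    | succ k => simp [coeff_monomial, Nat.factorial_succ]; ring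

theorem gammaFunctional_succ_derivative (p : ℕ) (q : R[X]) :
    gammaFunctional (p + 1) (derivative q) =
      gammaFunctional (p + 1) q - (p + 1) • gammaFunctional p q := by
  induction q using Polynomial.induction_on' with
  | add q r hq hr => simp only [map_add, hq, hr]; module
  | monomial k a =>
    rw [derivative_monomial, gammaFunctional_monomial, gammaFunctional_monomial,
      gammaFunctional_monomial, nsmul_eq_mul]
    cases k with
    | zero => simp [Nat.factorial_succ]; ring
    | succ k =>
      rw [Nat.add_sub_cancel, show p + 1 + (k + 1) = p + (k + 1) + 1 by ring,
        show p + 1 + k = p + (k + 1) by ring, Nat.factorial_succ]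
      push_cast
      ring

end GammaFunctional

section LaguerrePolynomial

open Polynomial

variable (K : Type*) [Field K]

/-- The `n`-th Laguerre polynomial, normalised by `L_n(0) = 1`, so that the `L_n` are orthonormal
for the weight `exp (-x)` on `[0, ∞)`. -/
noncomputable def laguerrePoly (n : ℕ) : K[X] :=
  ∑ k ∈ Finset.range (n + 1), monomial k ((-1 : K) ^ k * n.choose k / k.factorial)

theorem laguerrePoly_coeff (n k : ℕ) :
    (laguerrePoly K n).coeff k = (-1 : K) ^ k * n.choose k / k.factorial := by
  simp only [laguerrePoly, finsetSum_coeff, coeff_monomial, Finset.sum_ite_eq', Finset.mem_range]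
  split_ifs with h
  · rfl
  · rw [Nat.choose_eq_zero_of_lt (by lia), Nat.cast_zero, mul_zero, zero_div]

theorem laguerrePoly_natDegree_le (n : ℕ) : (laguerrePoly K n).natDegree ≤ n := by
  rw [natDegree_le_iff_coeff_eq_zero]
  intro k hk
  rw [laguerrePoly_coeff, Nat.choose_eq_zero_of_lt hk, Nat.cast_zero, mul_zero, zero_div]

theorem laguerrePoly_coeff_zero (n : ℕ) : (laguerrePoly K n).coeff 0 = 1 := by
  simp [laguerrePoly_coeff]

@[simp]
theorem laguerrePoly_zero : laguerrePoly K 0 = 1 := by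
  simp [laguerrePoly]

@[simp]
theorem laguerrePoly_one : laguerrePoly K 1 = 1 - X := by
  simp [laguerrePoly, Finset.sum_range_succ, ← C_mul_X_pow_eq_monomial, sub_eq_add_neg]

variable [CharZero K]

theorem derivative_laguerrePoly_succ (n : ℕ) :
    derivative (laguerrePoly K (n + 1)) = derivative (laguerrePoly K n) - laguerrePoly K n := by
  ext k
  simp only [coeff_sub, coeff_derivative, laguerrePoly_coeff, Nat.choose_succ_succ,
    Nat.factorial_succ]
  have hk : ((k + 1 : ℕ) : K) ≠ 0 := Nat.cast_ne_zero.mpr k.succ_ne_zero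
  push_cast at hk ⊢
  field_simp
  ring

theorem X_mul_derivative_laguerrePoly_succ (n : ℕ) :
    X * derivative (laguerrePoly K (n + 1)) =
      (n + 1) • (laguerrePoly K (n + 1) - laguerrePoly K n) := by
  ext k
  cases k with
  | zero => simp [laguerrePoly_coeff]
  | succ k =>
    have hchoose : ((n : K) + 1) * n.choose k = (n + 1).choose (k + 1) * (k + 1) := by
      exact_mod_cast n.add_one_mul_choose_eq k
    have hpascal : ((n + 1).choose (k + 1) : K) = n.choose k + n.choose (k + 1) := by
      exact_mod_cast n.choose_succ_succ k
    have hfact : ((k + 1).factorial : K) ≠ 0 := Nat.cast_ne_zero.mpr (k + 1).factorial_ne_zero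
    simp only [coeff_X_mul, coeff_derivative, coeff_smul, coeff_sub, laguerrePoly_coeff]
    push_cast [nsmul_eq_mul]
    field_simp
    linear_combination (-1 : K) * hchoose - (n + 1) * hpascal

theorem X_mul_derivative_laguerrePoly (n : ℕ) :
    X * derivative (laguerrePoly K n) =
      (n + 1) • laguerrePoly K (n + 1) - ((n + 1) • 1 - X) * laguerrePoly K n := by
  linear_combination
    X_mul_derivative_laguerrePoly_succ K n - X * derivative_laguerrePoly_succ K n

theorem laguerrePoly_add_two (n : ℕ) :
    (n + 2) • laguerrePoly K (n + 2) =
      ((2 * n + 3) • 1 - X) * laguerrePoly K (n + 1) - (n + 1) • laguerrePoly K n := by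
  linear_combination
    X_mul_derivative_laguerrePoly_succ K n - X_mul_derivative_laguerrePoly K (n + 1)

theorem derivative_X_mul_derivative_laguerrePoly (n : ℕ) :
    derivative (X * derivative (laguerrePoly K n)) =
      X * derivative (laguerrePoly K n) - n • laguerrePoly K n := by
  cases n with
  | zero => simp
  | succ n =>
    rw [X_mul_derivative_laguerrePoly_succ, derivative_smul, derivative_sub]
    linear_combination ((n : K[X]) + 1) * derivative_laguerrePoly_succ K n

theorem gammaFunctional_laguerrePoly_mul_of_ne {m n : ℕ} (h : m ≠ n) :
    gammaFunctional 0 (laguerrePoly K m * laguerrePoly K n) = 0 := by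
  -- The Wronskian turns the difference of the two eigenvalues into an exact derivative.
  set W := X * (derivative (laguerrePoly K m) * laguerrePoly K n -
    derivative (laguerrePoly K n) * laguerrePoly K m) with hW
  have hderiv : derivative W - W =
      n • (laguerrePoly K m * laguerrePoly K n) - m • (laguerrePoly K m * laguerrePoly K n) := by
    rw [hW, mul_sub, ← mul_assoc, ← mul_assoc, derivative_sub,
      derivative_mul (f := X * derivative (laguerrePoly K m)),
      derivative_mul (f := X * derivative (laguerrePoly K n)),
      derivative_X_mul_derivative_laguerrePoly, derivative_X_mul_derivative_laguerrePoly]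
    ring
  have hφ := congrArg (gammaFunctional 0) hderiv
  rw [map_sub, gammaFunctional_zero_derivative, hW, coeff_X_mul_zero, map_sub, map_nsmul, map_nsmul,
    ← hW, sub_zero, sub_self, nsmul_eq_mul, nsmul_eq_mul, ← sub_mul, eq_comm, mul_eq_zero] at hφ
  exact hφ.resolve_left (sub_ne_zero.mpr (Nat.cast_injective.ne h.symm))

theorem derivative_laguerrePoly_eq_neg_sum (n : ℕ) :
    derivative (laguerrePoly K n) = -∑ k ∈ Finset.range n, laguerrePoly K k := by
  induction n with
  | zero => simp
  | succ n ih => rw [derivative_laguerrePoly_succ, ih, Finset.sum_range_succ]; ring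

theorem gammaFunctional_derivative_laguerrePoly_mul_of_le {m n : ℕ} (h : m ≤ n) :
    gammaFunctional 0 (derivative (laguerrePoly K m) * laguerrePoly K n) = 0 := by
  rw [derivative_laguerrePoly_eq_neg_sum, neg_mul, map_neg, Finset.sum_mul, map_sum, neg_eq_zero]
  exact Finset.sum_eq_zero fun k hk =>
    gammaFunctional_laguerrePoly_mul_of_ne K ((Finset.mem_range.mp hk).trans_le h).ne

theorem gammaFunctional_laguerrePoly_mul_self (n : ℕ) :
    gammaFunctional 0 (laguerrePoly K n * laguerrePoly K n) = 1 := by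
  have hparts := gammaFunctional_zero_derivative (laguerrePoly K (n + 1) * laguerrePoly K n)
  rw [derivative_mul, derivative_laguerrePoly_succ, sub_mul, map_add, map_sub,
    gammaFunctional_derivative_laguerrePoly_mul_of_le K le_rfl,
    mul_comm (laguerrePoly K (n + 1)) (derivative _),
    gammaFunctional_derivative_laguerrePoly_mul_of_le K n.le_succ,
    gammaFunctional_laguerrePoly_mul_of_ne K n.succ_ne_self, mul_coeff_zero,
    laguerrePoly_coeff_zero, laguerrePoly_coeff_zero] at hparts
  linear_combination -hparts

end LaguerrePolynomial

section LaguerreKernel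

open Polynomial

variable (K : Type*) [Field K]

/-- The diagonal `∑_{k < n} L_k ^ 2` of the Christoffel–Darboux kernel of the Laguerre polynomials:
the mean eigenvalue density of the Laguerre ensemble, up to its exponential factor. -/
noncomputable def laguerreKernel (n : ℕ) : K[X] :=
  ∑ k ∈ Finset.range n, laguerrePoly K k * laguerrePoly K k

theorem laguerreKernel_succ (n : ℕ) :
    laguerreKernel K (n + 1) = laguerreKernel K n + laguerrePoly K n * laguerrePoly K n :=
  Finset.sum_range_succ _ n

variable [CharZero K]

theorem X_mul_laguerreKernel_succ (n : ℕ) :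
    X * laguerreKernel K (n + 1) =
      (n + 1) • ((n + 1) • (laguerrePoly K (n + 1) - laguerrePoly K n) ^ 2 +
        X * (laguerrePoly K (n + 1) * laguerrePoly K n)) := by
  induction n with
  | zero =>
    simp only [laguerreKernel, Finset.sum_range_one, laguerrePoly_zero, zero_add, laguerrePoly_one,
      one_smul]
    ring
  | succ n ih =>
    rw [laguerreKernel_succ, mul_add, ih]
    linear_combination
      (-((n : K[X]) + 2) * (laguerrePoly K (n + 2) - laguerrePoly K (n + 1)) -
        ((n + 1) * (laguerrePoly K (n + 1) - laguerrePoly K n) - X * laguerrePoly K (n + 1)) -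
        X * laguerrePoly K (n + 1)) * laguerrePoly_add_two K n

theorem X_mul_derivative_laguerreKernel_succ (n : ℕ) :
    X * derivative (laguerreKernel K (n + 1)) =
      X * laguerreKernel K (n + 1) - laguerreKernel K (n + 1) +
        (n + 1) • (laguerrePoly K (n + 1) * laguerrePoly K n) := by
  induction n with
  | zero =>
    simp only [laguerreKernel, Finset.sum_range_one, laguerrePoly_zero, zero_add, laguerrePoly_one,
      one_smul, mul_one, derivative_one]
    ring
  | succ n ih =>
    rw [laguerreKernel_succ, derivative_add, mul_add, ih, derivative_mul]
    linear_combination 2 * laguerrePoly K (n + 1) * X_mul_derivative_laguerrePoly_succ K n -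
      laguerrePoly K (n + 1) * laguerrePoly_add_two K n

theorem X_mul_derivative_laguerrePoly_succ_mul (n : ℕ) :
    X * derivative (laguerrePoly K (n + 1) * laguerrePoly K n) =
      X * (laguerrePoly K (n + 1) * laguerrePoly K n) +
        (n + 1) • (laguerrePoly K (n + 1) ^ 2 - laguerrePoly K n ^ 2) := by
  rw [derivative_mul]
  linear_combination laguerrePoly K n * X_mul_derivative_laguerrePoly_succ K n +
    laguerrePoly K (n + 1) * X_mul_derivative_laguerrePoly K n

theorem derivative_laguerrePoly_succ_sq_sub_sq (n : ℕ) :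
    (n + 1) ^ 2 • derivative (laguerrePoly K (n + 1) ^ 2 - laguerrePoly K n ^ 2) =
      (n + 1) ^ 2 • (laguerrePoly K (n + 1) ^ 2 - laguerrePoly K n ^ 2) +
        (2 * (n + 1)) • laguerreKernel K (n + 1) - X * laguerreKernel K (n + 1) +
        (n + 1) • (X * (laguerrePoly K (n + 1) * laguerrePoly K n)) -
        (4 * (n + 1) ^ 2) • (laguerrePoly K (n + 1) * laguerrePoly K n) := by
  apply mul_left_cancel₀ (X_ne_zero (R := K))
  rw [derivative_sub, sq (laguerrePoly K (n + 1)), sq (laguerrePoly K n), derivative_mul,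
    derivative_mul]
  linear_combination
    2 * ((n : K[X]) + 1) ^ 2 * laguerrePoly K (n + 1) * X_mul_derivative_laguerrePoly_succ K n -
    2 * ((n : K[X]) + 1) ^ 2 * laguerrePoly K n * X_mul_derivative_laguerrePoly K n -
    (2 * ((n : K[X]) + 1) - X) * X_mul_laguerreKernel_succ K n

theorem gammaFunctional_laguerreKernel_succ (n p : ℕ) :
    (p : K) * gammaFunctional p (laguerreKernel K (n + 1)) =
      -(((n : K) + 1) * gammaFunctional p (laguerrePoly K (n + 1) * laguerrePoly K n)) := by
  have h := congrArg (gammaFunctional p) (X_mul_derivative_laguerreKernel_succ K n)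
  simp only [map_add, map_sub, map_nsmul, gammaFunctional_X_mul, gammaFunctional_succ_derivative]
    at h
  push_cast [nsmul_eq_mul] at h
  linear_combination -h

theorem gammaFunctional_laguerrePoly_succ_mul (n p : ℕ) :
    ((p : K) + 1) * gammaFunctional p (laguerrePoly K (n + 1) * laguerrePoly K n) =
      -(((n : K) + 1) *
        gammaFunctional p (laguerrePoly K (n + 1) ^ 2 - laguerrePoly K n ^ 2)) := by
  have h := congrArg (gammaFunctional p) (X_mul_derivative_laguerrePoly_succ_mul K n)
  simp only [map_add, map_nsmul, gammaFunctional_X_mul, gammaFunctional_succ_derivative]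
    at h
  push_cast [nsmul_eq_mul] at h
  linear_combination -h

theorem gammaFunctional_zero_laguerreKernel (n : ℕ) :
    gammaFunctional 0 (laguerreKernel K n) = n := by
  simp [laguerreKernel, gammaFunctional_laguerrePoly_mul_self]

theorem gammaFunctional_one_laguerreKernel_succ (n : ℕ) :
    gammaFunctional 1 (laguerreKernel K (n + 1)) = ((n : K) + 1) ^ 2 := by
  have h := congrArg (gammaFunctional 0) (derivative_laguerrePoly_succ_sq_sub_sq K n)
  simp only [map_add, map_sub, map_nsmul, gammaFunctional_X_mul, gammaFunctional_zero_derivative,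
    gammaFunctional_zero_laguerreKernel, sq (laguerrePoly K _), mul_coeff_zero,
    laguerrePoly_coeff_zero, gammaFunctional_laguerrePoly_mul_self,
    gammaFunctional_laguerrePoly_mul_of_ne K n.succ_ne_self] at h
  have hparts := gammaFunctional_laguerreKernel_succ K n 1
  push_cast [nsmul_eq_mul] at h hparts
  linear_combination h / 2 + hparts / 2

theorem gammaFunctional_succ_derivative_sq_sub_sq (n p : ℕ) :
    ((n : K) + 1) ^ 2 * (p + 1) *
        gammaFunctional p (laguerrePoly K (n + 1) ^ 2 - laguerrePoly K n ^ 2) =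
      gammaFunctional (p + 2) (laguerreKernel K (n + 1)) -
        2 * (n + 1) * gammaFunctional (p + 1) (laguerreKernel K (n + 1)) -
        (n + 1) * gammaFunctional (p + 2) (laguerrePoly K (n + 1) * laguerrePoly K n) +
        4 * (n + 1) ^ 2 *
          gammaFunctional (p + 1) (laguerrePoly K (n + 1) * laguerrePoly K n) := by
  have h := congrArg (gammaFunctional (p + 1)) (derivative_laguerrePoly_succ_sq_sub_sq K n)
  simp only [map_add, map_sub, map_nsmul, gammaFunctional_X_mul, gammaFunctional_succ_derivative]
    at h ⊢
  push_cast [nsmul_eq_mul] at h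
  linear_combination -h

/-- The Haagerup–Thorbjørnsen recursion for the moments of the Laguerre ensemble. -/
theorem gammaFunctional_laguerreKernel_recursion (n p : ℕ) :
    ((p : K) + 3) * gammaFunctional (p + 2) (laguerreKernel K n) =
      (4 * p + 6) * n * gammaFunctional (p + 1) (laguerreKernel K n) +
        (p : K) * (p + 1) ^ 2 * gammaFunctional p (laguerreKernel K n) := by
  cases n with
  | zero => simp [laguerreKernel]
  | succ n =>
    have h₀ := gammaFunctional_laguerreKernel_succ K n p
    have h₁ := gammaFunctional_laguerreKernel_succ K n (p + 1)
    have h₂ := gammaFunctional_laguerreKernel_succ K n (p + 2)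
    push_cast at h₁ h₂ ⊢
    linear_combination h₂ - 4 * (n + 1) * h₁ - (p + 1) ^ 2 * h₀ -
      gammaFunctional_succ_derivative_sq_sub_sq K n p +
      (n + 1) * (p + 1) * gammaFunctional_laguerrePoly_succ_mul K n p

end LaguerreKernel

/-! ### Andréief's identity -/

section Andreief

open Matrix

variable {ι : Type*} [Fintype ι] [DecidableEq ι]

section CommRing

variable {R α : Type*} [CommRing R]

theorem det_updateCol_diagonal (d b : ι → R) (l : ι) :
    ((diagonal d).updateCol l b).det = (∏ i ∈ Finset.univ.erase l, d i) * b l := by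
  rw [← cramer_apply, cramer_eq_adjugate_mulVec, adjugate_diagonal, mulVec_diagonal]

theorem mul_det_mul_det_eq_sum_perm {S : (ι → α) → R}
    (hS : ∀ (σ : Equiv.Perm ι) y, S (y ∘ σ) = S y) (φ ψ : ι → α → R) (y : ι → α) :
    S y * ((of fun i j => φ i (y j)).det * (of fun i j => ψ i (y j)).det) =
      ∑ σ : Equiv.Perm ι, S (y ∘ σ) * ((of fun i j => φ i ((y ∘ σ) j)).det *
        ∏ i, ψ i ((y ∘ σ) i)) := by
  have hdet (σ : Equiv.Perm ι) : (of fun i j => φ i ((y ∘ σ) j)).det =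
      Equiv.Perm.sign σ * (of fun i j => φ i (y j)).det :=
    det_permute' σ (of fun i j => φ i (y j))
  have hexpand : (of fun i j => ψ i (y j)).det =
      ∑ σ : Equiv.Perm ι, Equiv.Perm.sign σ * ∏ i, ψ i (y (σ i)) := by
    rw [← det_transpose, det_apply']
    rfl
  rw [hexpand, Finset.mul_sum, Finset.mul_sum]
  refine Finset.sum_congr rfl fun σ _ => ?_
  rw [hS, hdet]
  simp only [Function.comp_apply]
  ring

theorem apply_mul_det_mul_prod_eq_det (f : α → R) (φ ψ : ι → α → R)
    (l : ι) (y : ι → α) :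
    f (y l) * ((of fun i j => φ i (y j)).det * ∏ i, ψ i (y i)) =
      (of fun i j => (if j = l then f (y j) else 1) * (φ i (y j) * ψ j (y j))).det := by
  have hf : f (y l) = ∏ j, if j = l then f (y j) else 1 := by
    rw [Finset.prod_ite_eq' Finset.univ l fun j => f (y j), if_pos (Finset.mem_univ l)]
  rw [hf, mul_comm (det _), ← mul_assoc, ← Finset.prod_mul_distrib, ← det_mul_row]
  congr! 3
  ext
  rw [of_apply]
  ring

end CommRing

variable {𝕜 : Type*} [RCLike 𝕜]

section Det

variable {E : ι → Type*} [∀ i, MeasurableSpace (E i)] {μ : ∀ i, Measure (E i)}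
  [∀ i, SigmaFinite (μ i)] {F : ι → ∀ j, E j → 𝕜}

theorem integrable_pi_det (hF : ∀ i j, Integrable (F i j) (μ j)) :
    Integrable (fun y => (of fun i j => F i j (y j)).det) (Measure.pi μ) := by
  simp only [det_apply', of_apply]
  exact integrable_finsetSum _ fun σ _ =>
    (Integrable.fintype_prod_dep fun j => hF (σ j) j).const_mul _

theorem integral_pi_det (hF : ∀ i j, Integrable (F i j) (μ j)) :
    ∫ y, (of fun i j => F i j (y j)).det ∂Measure.pi μ =
      (of fun i j => ∫ x, F i j x ∂μ j).det := by
  simp only [det_apply', of_apply]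
  rw [integral_finsetSum _ fun σ _ =>
    (Integrable.fintype_prod_dep fun j => hF (σ j) j).const_mul _]
  exact Finset.sum_congr rfl fun σ _ => by
    rw [integral_const_mul, integral_fintype_prod_eq_prod fun j => F (σ j) j]

end Det

variable {α : Type*} [MeasurableSpace α] {μ : Measure α} [SigmaFinite μ]

theorem integral_pi_sum_comp_perm {G : Type*} [NormedAddCommGroup G] [NormedSpace ℝ G]
    {g : (ι → α) → G} (hg : Integrable g (Measure.pi fun _ => μ)) :
    ∫ y, ∑ σ : Equiv.Perm ι, g (y ∘ σ) ∂Measure.pi (fun _ => μ) =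
      (Fintype.card ι).factorial • ∫ y, g y ∂Measure.pi fun _ => μ := by
  have hσ (σ : Equiv.Perm ι) :=
    measurePreserving_arrowCongr' (fun _ => μ) (fun _ => μ) σ.symm (.refl α) fun _ => .id μ
  have hint (σ : Equiv.Perm ι) : Integrable (fun y => g (y ∘ σ)) (Measure.pi fun _ => μ) :=
    ((hσ σ).integrable_comp_emb (MeasurableEquiv.measurableEmbedding _)).mpr hg
  have hval (σ : Equiv.Perm ι) :
      ∫ y, g (y ∘ σ) ∂Measure.pi (fun _ => μ) = ∫ y, g y ∂Measure.pi fun _ => μ :=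
    (hσ σ).integral_comp' g
  simp only [integral_finsetSum _ fun σ _ => hint σ, hval, Finset.sum_const, Finset.card_univ,
    Fintype.card_perm]

variable {f : α → 𝕜} {φ ψ : ι → α → 𝕜}

theorem integral_sum_mul_det_mul_det (hφψ : ∀ i j, Integrable (fun x => φ i x * ψ j x) μ)
    (hf : ∀ i j, Integrable (fun x => f x * (φ i x * ψ j x)) μ) :
    ∫ y, (∑ l, f (y l)) * ((of fun i j => φ i (y j)).det * (of fun i j => ψ i (y j)).det)
        ∂Measure.pi (fun _ => μ) =
      (Fintype.card ι).factorial • ∑ l, ((of fun i j => ∫ x, φ i x * ψ j x ∂μ).updateCol l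
        fun i => ∫ x, f x * (φ i x * ψ l x) ∂μ).det := by
  have hint (l i j : ι) :
      Integrable (fun x => (if j = l then f x else 1) * (φ i x * ψ j x)) μ := by
    split_ifs
    · exact hf i j
    · simpa only [one_mul] using hφψ i j
  have hsymm (σ : Equiv.Perm ι) (y : ι → α) : ∑ l, f ((y ∘ σ) l) = ∑ l, f (y l) :=
    Equiv.sum_comp σ fun l => f (y l)
  have hexpand (y : ι → α) :
      (∑ l, f (y l)) * ((of fun i j => φ i (y j)).det * ∏ i, ψ i (y i)) =
        ∑ l, (of fun i j => (if j = l then f (y j) else 1) * (φ i (y j) * ψ j (y j))).det := by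
    rw [Finset.sum_mul]
    exact Finset.sum_congr rfl fun l _ => apply_mul_det_mul_prod_eq_det f φ ψ l y
  simp only [mul_det_mul_det_eq_sum_perm (S := fun y => ∑ l, f (y l)) hsymm]
  rw [integral_pi_sum_comp_perm (g := fun y => (∑ l, f (y l)) *
    ((of fun i j => φ i (y j)).det * ∏ i, ψ i (y i)))]
  · simp only [hexpand]
    rw [integral_finsetSum _ fun l _ => integrable_pi_det (hint l)]
    congr! 2 with l
    rw [integral_pi_det (hint l)]
    congr 1
    ext i j
    by_cases hj : j = l <;> simp [hj]
  · simp only [hexpand]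
    exact integrable_finsetSum _ fun l _ => integrable_pi_det (hint l)

end Andreief

/-! ### The Laguerre ensemble -/

section LaguerreEnsemble

open Polynomial

theorem integrableOn_eval_mul_exp_neg (q : ℝ[X]) :
    IntegrableOn (fun x => q.eval x * Real.exp (-x)) (Set.Ioi 0) := by
  simp only [eval_eq_sum_range, Finset.sum_mul]
  refine integrable_finsetSum _ fun k _ => ?_
  have h := (Real.GammaIntegral_convergent (s := k + 1) (by positivity)).const_mul (q.coeff k)
  simp only [add_sub_cancel_right, Real.rpow_natCast] at h
  exact h.congr (.of_forall fun x => by ring)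

theorem integral_eval_mul_exp_neg (q : ℝ[X]) :
    ∫ x in Set.Ioi 0, q.eval x * Real.exp (-x) = gammaFunctional 0 q := by
  induction q using Polynomial.induction_on' with
  | add p q hp hq =>
    simp only [eval_add, add_mul]
    rw [integral_add (integrableOn_eval_mul_exp_neg p) (integrableOn_eval_mul_exp_neg q), hp, hq,
      map_add]
  | monomial k a =>
    have hGamma := Real.Gamma_eq_integral (s := k + 1) (by positivity)
    simp only [Real.Gamma_nat_eq_factorial, add_sub_cancel_right, Real.rpow_natCast] at hGamma
    rw [gammaFunctional_monomial, zero_add, hGamma, mul_comm, ← integral_const_mul]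
    simp only [eval_monomial, mul_assoc, mul_comm (Real.exp _)]

variable {c : ℝ}

theorem integrableOn_eval_mul_mul_exp_neg_mul (hc : 0 < c) (q : ℝ[X]) :
    IntegrableOn (fun x => q.eval (c * x) * Real.exp (-(c * x))) (Set.Ioi 0) := by
  rw [integrableOn_Ioi_comp_mul_left_iff (fun x => q.eval x * Real.exp (-x)) 0 hc, mul_zero]
  exact integrableOn_eval_mul_exp_neg q

theorem integral_eval_mul_mul_exp_neg_mul (hc : 0 < c) (q : ℝ[X]) :
    ∫ x in Set.Ioi 0, q.eval (c * x) * Real.exp (-(c * x)) = c⁻¹ * gammaFunctional 0 q := by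
  rw [integral_comp_mul_left_Ioi (fun x => q.eval x * Real.exp (-x)) 0 hc, mul_zero,
    integral_eval_mul_exp_neg, smul_eq_mul]

theorem integrableOn_eval_mul_exp_mul_eval_mul_eval (hc : 0 < c) (q p r : ℝ[X]) :
    IntegrableOn (fun x => q.eval (c * x) *
      (Real.exp (-(c * x)) * p.eval (c * x) * r.eval (c * x))) (Set.Ioi 0) := by
  refine (integrableOn_eval_mul_mul_exp_neg_mul hc (q * (p * r))).congr (.of_forall fun x => ?_)
  simp only [eval_mul]
  ring

theorem integral_eval_mul_exp_mul_eval_mul_eval (hc : 0 < c) (q p r : ℝ[X]) :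
    ∫ x in Set.Ioi 0, q.eval (c * x) * (Real.exp (-(c * x)) * p.eval (c * x) * r.eval (c * x)) =
      c⁻¹ * gammaFunctional 0 (q * (p * r)) := by
  rw [← integral_eval_mul_mul_exp_neg_mul hc]
  refine integral_congr_ae (.of_forall fun x => ?_)
  simp only [eval_mul]
  ring

theorem integral_exp_mul_laguerrePoly_mul_eq_diagonal (hc : 0 < c) (n : ℕ) :
    (Matrix.of fun i j : Fin n => ∫ x in Set.Ioi 0, Real.exp (-(c * x)) *
      (laguerrePoly ℝ i).eval (c * x) * (laguerrePoly ℝ j).eval (c * x)) =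
      Matrix.diagonal fun _ => c⁻¹ := by
  ext i j
  have h := integral_eval_mul_exp_mul_eval_mul_eval hc 1 (laguerrePoly ℝ i) (laguerrePoly ℝ j)
  simp only [eval_one, one_mul] at h
  rw [Matrix.of_apply, h, Matrix.diagonal_apply]
  split_ifs with hij
  · rw [hij, gammaFunctional_laguerrePoly_mul_self, mul_one]
  · rw [gammaFunctional_laguerrePoly_mul_of_ne ℝ (Fin.val_ne_of_ne hij), mul_zero]

theorem det_eval_eq_det_vandermonde_mul {R : Type*} [CommRing R] {n : ℕ} (v : Fin n → R)
    (p : Fin n → R[X]) (hdeg : ∀ i, (p i).natDegree ≤ i) :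
    (Matrix.of fun i j => (p i).eval (v j)).det =
      (Matrix.vandermonde v).det * ∏ i, (p i).coeff i := by
  rw [← Matrix.det_transpose]
  change (Matrix.of fun i j => (p j).eval (v i)).det = _
  rw [Matrix.eval_matrixOfPolynomials_eq_vandermonde_mul_matrixOfPolynomials v p hdeg,
    Matrix.det_mul,
    Matrix.det_of_isUpperTriangular (M := Matrix.of fun i j : Fin n => (p j).coeff i)]
  · rfl
  · exact fun i j hij => coeff_eq_zero_of_natDegree_lt ((hdeg j).trans_lt hij)

variable (N : ℕ)

/-- The product of the leading coefficients of the polynomials `L_i(N x)` for `i < N`. -/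
noncomputable def laguerreLeadingCoeff : ℝ :=
  ∏ i : Fin N, ((laguerrePoly ℝ i).comp (C (N : ℝ) * X)).coeff i

theorem laguerreLeadingCoeff_ne_zero : laguerreLeadingCoeff N ≠ 0 := by
  refine Finset.prod_ne_zero_iff.mpr fun i _ => ?_
  have hN : (N : ℝ) ≠ 0 := Nat.cast_ne_zero.mpr i.pos.ne'
  rw [comp_C_mul_X_coeff, laguerrePoly_coeff, Nat.choose_self]
  positivity

theorem det_laguerrePoly_sq (y : Fin N → ℝ) :
    (Matrix.of fun i j : Fin N => (laguerrePoly ℝ i).eval (N * y j)).det ^ 2 =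
      laguerreLeadingCoeff N ^ 2 * (∏ i, ∏ j ∈ Finset.Ioi i, (y i - y j)) ^ 2 := by
  have hdeg (i : Fin N) : ((laguerrePoly ℝ i).comp (C (N : ℝ) * X)).natDegree ≤ i :=
    natDegree_comp_le.trans <| (Nat.mul_le_mul (laguerrePoly_natDegree_le ℝ i)
      ((natDegree_C_mul_le _ _).trans natDegree_X_le)).trans (mul_one _).le
  have h := det_eval_eq_det_vandermonde_mul y _ hdeg
  simp only [eval_comp, eval_mul, eval_C, eval_X] at h
  rw [h, Matrix.det_vandermonde, mul_pow, mul_comm, ← laguerreLeadingCoeff]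
  simp only [← Finset.prod_pow, sub_sq_comm]

theorem laguerreLeadingCoeff_sq_mul_laguerreWeight (y : Fin N → ℝ) :
    laguerreLeadingCoeff N ^ 2 * laguerreWeight N y =
      (Matrix.of fun i j : Fin N =>
          Real.exp (-(N * y j)) * (laguerrePoly ℝ i).eval (N * y j)).det *
        (Matrix.of fun i j : Fin N => (laguerrePoly ℝ i).eval (N * y j)).det := by
  have hexp : ∏ j, Real.exp (-(N * y j)) = Real.exp (-(N : ℝ) * ∑ i, y i) := by
    rw [← Real.exp_sum, Finset.mul_sum]
    simp only [neg_mul]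
  have hdet := Matrix.det_mul_row (fun j => Real.exp (-(N * y j)))
    (Matrix.of fun i j : Fin N => (laguerrePoly ℝ i).eval (N * y j))
  simp only [Matrix.of_apply] at hdet
  rw [hdet, hexp, mul_assoc, ← sq, det_laguerrePoly_sq, laguerreWeight, mul_left_comm]

variable {N}

theorem setIntegral_laguerreWeight_mul_sum_eval (hN : 0 < N) (q : ℝ[X]) :
    laguerreLeadingCoeff N ^ 2 * ∫ y in {y : Fin N → ℝ | ∀ i, 0 ≤ y i},
        laguerreWeight N y * ∑ i, q.eval (N * y i) =
      N.factorial * (N : ℝ)⁻¹ ^ N * gammaFunctional 0 (q * laguerreKernel ℝ N) := by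
  have hN' : (0 : ℝ) < N := Nat.cast_pos.mpr hN
  have horthant : {y : Fin N → ℝ | ∀ i, 0 ≤ y i} = Set.univ.pi fun _ => Set.Ici 0 := by
    ext y
    simp [Pi.le_def]
  have hkernel : gammaFunctional 0 (q * laguerreKernel ℝ N) =
      ∑ i : Fin N, gammaFunctional 0 (q * (laguerrePoly ℝ i * laguerrePoly ℝ i)) := by
    rw [laguerreKernel, Finset.mul_sum, map_sum, Fin.sum_univ_eq_sum_range
      fun k => gammaFunctional 0 (q * (laguerrePoly ℝ k * laguerrePoly ℝ k))]
  rw [← integral_const_mul]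
  simp only [← mul_assoc, laguerreLeadingCoeff_sq_mul_laguerreWeight]
  simp only [mul_comm _ (∑ _i, q.eval _)]
  rw [horthant, volume_pi, Measure.restrict_pi_pi,
    Measure.restrict_congr_set Ioi_ae_eq_Ici.symm, integral_sum_mul_det_mul_det (𝕜 := ℝ)
      (φ := fun (i : Fin N) x => Real.exp (-(N * x)) * (laguerrePoly ℝ i).eval (N * x))
      (ψ := fun (i : Fin N) x => (laguerrePoly ℝ i).eval (N * x))
      (f := fun x => q.eval (N * x))
      (fun i j => by simpa using! integrableOn_eval_mul_exp_mul_eval_mul_eval hN' 1 _ _)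
      (fun i j => integrableOn_eval_mul_exp_mul_eval_mul_eval hN' q _ _),
    integral_exp_mul_laguerrePoly_mul_eq_diagonal hN']
  simp only [det_updateCol_diagonal, integral_eval_mul_exp_mul_eval_mul_eval hN',
    Finset.prod_const, Finset.card_erase_of_mem (Finset.mem_univ _), Finset.card_univ,
    Fintype.card_fin, nsmul_eq_mul]
  rw [hkernel, mul_assoc, ← Finset.mul_sum, ← Finset.mul_sum, ← mul_assoc _ (N : ℝ)⁻¹,
    ← pow_succ, Nat.sub_add_cancel hN]

theorem laguerreTraceMean_eval (hN : 0 < N) (q : ℝ[X]) :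
    laguerreTraceMean N (fun t => q.eval (N * t)) = gammaFunctional 0 (q * laguerreKernel ℝ N) := by
  have hq := setIntegral_laguerreWeight_mul_sum_eval hN q
  have hN' : (N : ℝ) ≠ 0 := Nat.cast_ne_zero.mpr hN.ne'
  have hZ : laguerreLeadingCoeff N ^ 2 * laguerreZ N = N.factorial * (N : ℝ)⁻¹ ^ N := by
    have h := setIntegral_laguerreWeight_mul_sum_eval hN 1
    simp only [eval_one, Finset.sum_const, Finset.card_univ, Fintype.card_fin, nsmul_eq_mul,
      mul_one, one_mul, gammaFunctional_zero_laguerreKernel, integral_mul_const,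
      ← mul_assoc] at h
    exact mul_right_cancel₀ hN' h
  have hZ0 : laguerreZ N ≠ 0 := by
    refine right_ne_zero_of_mul (a := laguerreLeadingCoeff N ^ 2) ?_
    rw [hZ]
    positivity
  rw [laguerreTraceMean, one_div_mul_eq_div, div_eq_iff hZ0]
  refine mul_left_cancel₀ (pow_ne_zero 2 (laguerreLeadingCoeff_ne_zero N)) ?_
  rw [hq, ← hZ]
  ring

theorem pow_mul_laguerreMoment (hN : 0 < N) (m : ℕ) :
    (N : ℝ) ^ m * laguerreMoment N m = gammaFunctional m (laguerreKernel ℝ N) := by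
  have h := laguerreTraceMean_eval hN (X ^ m)
  simp only [eval_pow, eval_X, mul_pow, gammaFunctional_X_pow_mul, zero_add] at h
  rw [← h, laguerreMoment, laguerreTraceMean, laguerreTraceMean, mul_left_comm,
    ← integral_const_mul]
  simp only [Finset.mul_sum, mul_left_comm]

theorem laguerreMoment_zero (hN : 0 < N) : laguerreMoment N 0 = N := by
  simpa only [pow_zero, one_mul, gammaFunctional_zero_laguerreKernel] using
    pow_mul_laguerreMoment hN 0

theorem laguerreMoment_one (hN : 0 < N) : laguerreMoment N 1 = N := by
  obtain ⟨n, rfl⟩ := Nat.exists_eq_add_one.mpr hN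
  have h := pow_mul_laguerreMoment hN 1
  rw [gammaFunctional_one_laguerreKernel_succ, pow_one, sq, Nat.cast_add_one] at h
  rw [Nat.cast_add_one]
  exact mul_left_cancel₀ n.cast_add_one_ne_zero h

theorem laguerreMoment_add_two (hN : 0 < N) (p : ℕ) :
    (p + 3) * laguerreMoment N (p + 2) = (4 * p + 6) * laguerreMoment N (p + 1) +
      p * (p + 1) ^ 2 * ((N : ℝ) ^ (-2 : ℤ) * laguerreMoment N p) := by
  have h := gammaFunctional_laguerreKernel_recursion ℝ N p
  have hN' : (N : ℝ) ≠ 0 := Nat.cast_ne_zero.mpr hN.ne'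
  simp only [← pow_mul_laguerreMoment hN] at h
  refine mul_left_cancel₀ (pow_ne_zero (p + 2) hN') ?_
  have hsq : (N : ℝ) ^ 2 * (N : ℝ) ^ (-2 : ℤ) = 1 := by
    rw [zpow_neg]
    exact mul_inv_cancel₀ (pow_ne_zero 2 hN')
  linear_combination h - p * (p + 1) ^ 2 * (N : ℝ) ^ p * laguerreMoment N p * hsq

end LaguerreEnsemble

/-! ### The five-term recursion -/

section FiveTermRecursion

/-- The five-term operator on the right-hand side of the recursion in `SatisfiesVRecursion`. -/
noncomputable def fiveTerm (a : ℤ → ℝ) (k : ℤ) : ℝ :=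
  (2 * (k : ℝ) + 7) * (2 * k + 5) * (2 * k + 3) / 32 * a (k + 3)
    - (2 * (k : ℝ) + 5) * (2 * k + 3) * (k + 1) / 4 * a (k + 2)
    + 3 * (2 * (k : ℝ) + 3) * (2 * k + 1) ^ 2 / 16 * a (k + 1)
    - (2 * (k : ℝ) + 1) * k * (2 * k - 1) / 4 * a k
    + (2 * (k : ℝ) - 1) ^ 2 * (2 * k - 3) / 32 * a (k - 1)

/-- The transpose of `fiveTerm` for the pairing `∑ a_k f_k`. -/
noncomputable def fiveTermTranspose (f : ℤ → ℝ) (k : ℤ) : ℝ :=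
  (2 * (k : ℝ) + 1) * (2 * k - 1) * (2 * k - 3) / 32 * f (k - 3)
    - (2 * (k : ℝ) + 1) * (2 * k - 1) * (k - 1) / 4 * f (k - 2)
    + 3 * (2 * (k : ℝ) + 1) * (2 * k - 1) ^ 2 / 16 * f (k - 1)
    - (2 * (k : ℝ) + 1) * k * (2 * k - 1) / 4 * f k
    + (2 * (k : ℝ) + 1) ^ 2 * (2 * k - 1) / 32 * f (k + 1)

theorem fiveTerm_eq_zero {a : ℤ → ℝ} {m n : ℤ} (ha : ∀ k, k < m ∨ n < k → a k = 0) {k : ℤ}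
    (hk : k < m - 3 ∨ n + 1 < k) : fiveTerm a k = 0 := by
  rw [fiveTerm, ha (k + 3) (by lia), ha (k + 2) (by lia), ha (k + 1) (by lia), ha k (by lia),
    ha (k - 1) (by lia)]
  ring

theorem summable_mul_of_finite_support {a : ℤ → ℝ} (ha : (Function.support a).Finite)
    (f : ℤ → ℝ) : Summable fun k => a k * f k :=
  summable_of_hasFiniteSupport (ha.subset (Function.support_mul_subset_left _ _))

theorem tsum_fiveTerm_mul {a : ℤ → ℝ} (ha : (Function.support a).Finite) (f : ℤ → ℝ) :
    ∑' k, fiveTerm a k * f k = ∑' k, a k * fiveTermTranspose f k := by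
  have hshift (s : ℤ) (d : ℤ → ℝ) :
      HasSum (fun k => a (k + s) * d (k + s)) (∑' k, a k * d k) :=
    (Equiv.addRight s).hasSum_iff.mpr (summable_mul_of_finite_support ha d).hasSum
  let d₃ (k : ℤ) := (2 * (k : ℝ) + 1) * (2 * k - 1) * (2 * k - 3) / 32 * f (k - 3)
  let d₂ (k : ℤ) := (2 * (k : ℝ) + 1) * (2 * k - 1) * (k - 1) / 4 * f (k - 2)
  let d₁ (k : ℤ) := 3 * (2 * (k : ℝ) + 1) * (2 * k - 1) ^ 2 / 16 * f (k - 1)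
  let d₀ (k : ℤ) := (2 * (k : ℝ) + 1) * k * (2 * k - 1) / 4 * f k
  let e₁ (k : ℤ) := (2 * (k : ℝ) + 1) ^ 2 * (2 * k - 1) / 32 * f (k + 1)
  have hleft := (((hshift 3 d₃).sub (hshift 2 d₂)).add (hshift 1 d₁)).sub (hshift 0 d₀) |>.add
    (hshift (-1) e₁)
  have hright := (((hshift 0 d₃).sub (hshift 0 d₂)).add (hshift 0 d₁)).sub (hshift 0 d₀) |>.add
    (hshift 0 e₁)
  rw [← hleft.tsum_eq] at hright
  refine .trans (tsum_congr fun k => ?_) (hright.tsum_eq.symm.trans (tsum_congr fun k => ?_))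
  · simp only [fiveTerm, d₃, d₂, d₁, d₀, e₁, add_sub_cancel_right, ← sub_eq_add_neg,
      sub_add_cancel, add_zero]
    push_cast
    ring
  · simp only [fiveTermTranspose, d₃, d₂, d₁, d₀, e₁, add_zero]
    ring

/-- The symmetric form `∑ (4k² - 1) a_k b_{-k}`, for which both `fiveTerm` and multiplication by
the index are skew. -/
noncomputable def reflectionForm (a b : ℤ → ℝ) : ℝ :=
  ∑' k : ℤ, a k * ((4 * (k : ℝ) ^ 2 - 1) * b (-k))

theorem reflectionForm_comm (a b : ℤ → ℝ) : reflectionForm a b = reflectionForm b a := by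
  rw [reflectionForm, ← (Equiv.neg ℤ).tsum_eq]
  refine tsum_congr fun k => ?_
  rw [Equiv.neg_apply, neg_neg, Int.cast_neg, neg_sq]
  ring

theorem reflectionForm_fiveTerm_left {a : ℤ → ℝ} (ha : (Function.support a).Finite)
    (b : ℤ → ℝ) : reflectionForm (fiveTerm a) b = -reflectionForm a (fiveTerm b) := by
  rw [reflectionForm, tsum_fiveTerm_mul ha, reflectionForm, ← tsum_neg]
  refine tsum_congr fun k => ?_
  simp only [fiveTerm, fiveTermTranspose, neg_sub, neg_add_rev]
  rw [show -k + 3 = 3 - k by ring, show -k + 2 = 2 - k by ring, show -k + 1 = 1 - k by ring,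
    show -1 + -k = -k - 1 by ring]
  push_cast
  ring

theorem reflectionForm_index_mul_left (a b : ℤ → ℝ) :
    reflectionForm (fun k => 4 * k * a k) b = -reflectionForm a fun k => 4 * k * b k := by
  rw [reflectionForm, reflectionForm, ← tsum_neg]
  refine tsum_congr fun k => ?_
  push_cast
  ring

/-- Moving the two skew operators across the form one step at a time leads from the form of
`fiveTerm (a n)` and `a 0` to minus itself. -/
theorem reflectionForm_fiveTerm_eq_zero {a : ℕ → ℤ → ℝ} {n : ℕ}
    (hfin : ∀ g, (Function.support (a g)).Finite)
    (hrec : ∀ g < n, (fun k : ℤ => 4 * (k : ℝ) * a (g + 1) k) = fiveTerm (a g)) :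
    reflectionForm (fiveTerm (a n)) (a 0) = 0 := by
  have hladder (i j : ℕ) (hij : i + j = n) :
      reflectionForm (fiveTerm (a j)) (a i) = reflectionForm (fiveTerm (a n)) (a 0) := by
    induction i generalizing j with
    | zero => rw [← hij, zero_add]
    | succ i ih =>
      rw [← ih (j + 1) (by lia), reflectionForm_fiveTerm_left (hfin (j + 1)),
        ← hrec i (by lia), ← hrec j (by lia), reflectionForm_index_mul_left]
  have hends := hladder n 0 (add_zero n)
  rw [reflectionForm_fiveTerm_left (hfin 0), reflectionForm_comm] at hends
  linarith

/-- The solution of the recursion in `SatisfiesVRecursion`; the coefficient at `k = 0`, where the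
recursion is silent, is fixed by the vanishing of the sum. -/
noncomputable def vCoeff : ℕ → ℤ → ℝ
  | 0, k => if k = 0 then -1 / 2 else 0
  | g + 1, k =>
    if k = 0 then
      -∑ j ∈ (Finset.Icc (-3 * ((g + 1 : ℕ) : ℤ)) (g + 1 : ℕ)).erase 0,
        fiveTerm (vCoeff g) j / (4 * j)
    else fiveTerm (vCoeff g) k / (4 * k)

theorem vCoeff_zero (k : ℤ) : vCoeff 0 k = if k = 0 then -1 / 2 else 0 := by
  rw [vCoeff]

theorem vCoeff_succ_of_ne {k : ℤ} (hk : k ≠ 0) (g : ℕ) :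
    vCoeff (g + 1) k = fiveTerm (vCoeff g) k / (4 * k) := by
  rw [vCoeff, if_neg hk]

theorem genusSupported_vCoeff : GenusSupported vCoeff := by
  intro g k hk
  induction g generalizing k with
  | zero => rw [vCoeff_zero, if_neg (by lia)]
  | succ g ih =>
    rw [vCoeff_succ_of_ne (by lia), fiveTerm_eq_zero ih (by lia), zero_div]

theorem zero_mem_Icc_neg_three_mul (g : ℕ) : (0 : ℤ) ∈ Finset.Icc (-3 * (g : ℤ)) g :=
  Finset.mem_Icc.mpr ⟨by lia, by lia⟩

theorem sum_vCoeff_succ (g : ℕ) :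
    ∑ k ∈ Finset.Icc (-3 * ((g + 1 : ℕ) : ℤ)) (g + 1 : ℕ), vCoeff (g + 1) k = 0 := by
  rw [← Finset.add_sum_erase _ _ (zero_mem_Icc_neg_three_mul (g + 1)), vCoeff, if_pos rfl,
    neg_add_eq_zero]
  exact Finset.sum_congr rfl fun k hk => (vCoeff_succ_of_ne (Finset.ne_of_mem_erase hk) g).symm

theorem GenusSupported.finite_support {a : ℕ → ℤ → ℝ} (ha : GenusSupported a) (g : ℕ) :
    (Function.support (a g)).Finite := by
  refine (Set.finite_Icc (-3 * (g : ℤ)) g).subset fun k hk => ?_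
  contrapose! hk
  rw [Set.mem_Icc] at hk
  exact Function.notMem_support.mpr (ha g k (by lia))

theorem GenusSupported.tsum_mul_eq {a : ℕ → ℤ → ℝ} (ha : GenusSupported a) (g : ℕ) (f : ℤ → ℝ) :
    ∑' k, a g k * f k = ∑ k ∈ Finset.Icc (-3 * (g : ℤ)) g, a g k * f k := by
  refine tsum_eq_sum fun k hk => ?_
  rw [Finset.mem_Icc] at hk
  rw [ha g k (by lia), zero_mul]

/-- The solvability condition of the recursion at `k = 0`: pairing with `vCoeff 0`, which is
supported at `0`, extracts this value. -/
theorem fiveTerm_vCoeff_apply_zero (g : ℕ) : fiveTerm (vCoeff g) 0 = 0 := by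
  induction g using Nat.strong_induction_on with
  | _ g ih =>
    have hrec (h : ℕ) (hh : h < g) :
        (fun k : ℤ => 4 * (k : ℝ) * vCoeff (h + 1) k) = fiveTerm (vCoeff h) := by
      ext k
      by_cases hk : k = 0
      · rw [hk, ih h hh, Int.cast_zero, mul_zero, zero_mul]
      · rw [vCoeff_succ_of_ne hk, mul_div_cancel₀ _ (by simpa using hk)]
    have hform : reflectionForm (fiveTerm (vCoeff g)) (vCoeff 0) = fiveTerm (vCoeff g) 0 / 2 := by
      rw [reflectionForm, tsum_eq_single 0 fun k hk => by simp [vCoeff_zero, hk]]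
      simp only [vCoeff_zero, neg_zero, if_true, Int.cast_zero]
      ring
    have hzero := reflectionForm_fiveTerm_eq_zero genusSupported_vCoeff.finite_support hrec
    linarith

theorem index_mul_vCoeff_succ (g : ℕ) (k : ℤ) :
    4 * (k : ℝ) * vCoeff (g + 1) k = fiveTerm (vCoeff g) k := by
  by_cases hk : k = 0
  · rw [hk, fiveTerm_vCoeff_apply_zero, Int.cast_zero, mul_zero, zero_mul]
  · rw [vCoeff_succ_of_ne hk, mul_div_cancel₀ _ (by simpa using hk)]

theorem satisfiesVRecursion_vCoeff : SatisfiesVRecursion vCoeff := by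
  refine ⟨genusSupported_vCoeff, vCoeff_zero, fun g k hg _ => ?_, fun g hg => ?_⟩
  all_goals obtain ⟨g, rfl⟩ := Nat.exists_eq_add_one.mpr hg
  · exact index_mul_vCoeff_succ g k
  · exact sum_vCoeff_succ g

theorem SatisfiesVRecursion.eq {a b : ℕ → ℤ → ℝ} (ha : SatisfiesVRecursion a)
    (hb : SatisfiesVRecursion b) : a = b := by
  obtain ⟨-, ha₀, ha_rec, ha_sum⟩ := ha
  obtain ⟨-, hb₀, hb_rec, hb_sum⟩ := hb
  ext g k
  induction g generalizing k with
  | zero => rw [ha₀, hb₀]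
  | succ g ih =>
    have hne (j : ℤ) (hj : j ≠ 0) : a (g + 1) j = b (g + 1) j := by
      refine mul_left_cancel₀ (mul_ne_zero four_ne_zero (Int.cast_ne_zero.mpr hj)) ?_
      simp only [ha_rec (g + 1) j g.succ_pos hj, hb_rec (g + 1) j g.succ_pos hj,
        Nat.add_sub_cancel, ih]
    by_cases hk : k = 0
    · have hsum := (ha_sum (g + 1) g.succ_pos).trans (hb_sum (g + 1) g.succ_pos).symm
      rw [← Finset.add_sum_erase _ (a (g + 1)) (zero_mem_Icc_neg_three_mul (g + 1)),
        ← Finset.add_sum_erase _ (b (g + 1)) (zero_mem_Icc_neg_three_mul (g + 1)),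
        Finset.sum_congr rfl fun j hj => hne j (Finset.ne_of_mem_erase hj)] at hsum
      rw [hk]
      exact add_right_cancel hsum
    · exact hne k hk

theorem satisfiesVRecursion_iff_eq_vCoeff (b : ℕ → ℤ → ℝ) :
    SatisfiesVRecursion b ↔ b = vCoeff :=
  ⟨fun hb => hb.eq satisfiesVRecursion_vCoeff, fun hb => hb ▸ satisfiesVRecursion_vCoeff⟩

end FiveTermRecursion

/-! ### Coefficients of the expansion at infinity -/

section SeriesCoefficients

theorem succ_mul_choose_succ {R : Type*} [Ring R] [BinomialRing R] (r : R) (m : ℕ) :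
    (m + 1) * Ring.choose r (m + 1) = Ring.choose r m * (r - m) := by
  have h := Ring.choose_smul_choose r m.le_succ
  rw [Nat.choose_succ_self_right, Nat.succ_sub m.le_refl, Nat.sub_self, Ring.choose_one_right,
    nsmul_eq_mul] at h
  exact_mod_cast h

/-- The coefficient of `z^m` in `(1 - 4z)^{k + 1/2}`, which is `v_k` as a function of `z = 1/x`. -/
noncomputable def halfBinomCoeff (m : ℕ) (k : ℤ) : ℝ :=
  (-4) ^ m * Ring.choose ((k : ℝ) + 1 / 2) m

theorem halfBinomCoeff_zero (k : ℤ) : halfBinomCoeff 0 k = 1 := by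
  rw [halfBinomCoeff, pow_zero, Ring.choose_zero_right, mul_one]

theorem halfBinomCoeff_succ (m : ℕ) (k : ℤ) :
    ((m : ℝ) + 1) * halfBinomCoeff (m + 1) k = (4 * m - 4 * k - 2) * halfBinomCoeff m k := by
  rw [halfBinomCoeff, halfBinomCoeff, pow_succ]
  linear_combination (-4) * (-4) ^ m * succ_mul_choose_succ ((k : ℝ) + 1 / 2) m

theorem halfBinomCoeff_succ_add_one (m : ℕ) (k : ℤ) :
    halfBinomCoeff (m + 1) (k + 1) = halfBinomCoeff (m + 1) k - 4 * halfBinomCoeff m k := by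
  have hpascal := Ring.choose_succ_succ ((k : ℝ) + 1 / 2) m
  rw [halfBinomCoeff, halfBinomCoeff, halfBinomCoeff, Int.cast_add, Int.cast_one,
    add_right_comm (k : ℝ), hpascal]
  ring

theorem mul_halfBinomCoeff_sub_one (m : ℕ) (k : ℤ) :
    ((k : ℝ) + 1 / 2) * halfBinomCoeff m (k - 1) = (k + 1 / 2 - m) * halfBinomCoeff m k := by
  have hk := halfBinomCoeff_succ m k
  have hk_sub := halfBinomCoeff_succ m (k - 1)
  have hpascal := halfBinomCoeff_succ_add_one m (k - 1)
  rw [sub_add_cancel] at hpascal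
  push_cast at hk_sub
  linear_combination (m + 1) / 4 * hpascal - hk / 4 + hk_sub / 4

theorem sq_mul_sub_one_mul_halfBinomCoeff (n : ℕ) (k : ℤ) :
    (n : ℝ) ^ 2 * (n - 1) * halfBinomCoeff n k = ((k : ℝ) + 1 / 2) * (k - 1 / 2) *
      ((k + 1 / 2) * halfBinomCoeff n k - (3 * k - 1 / 2) * halfBinomCoeff n (k - 1)
        + (3 * k - 5 / 2) * halfBinomCoeff n (k - 2)
        - (k - 3 / 2) * halfBinomCoeff n (k - 3)) := by
  have h₀ := mul_halfBinomCoeff_sub_one n k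
  have h₁ := mul_halfBinomCoeff_sub_one n (k - 1)
  have h₂ := mul_halfBinomCoeff_sub_one n (k - 2)
  rw [show k - 1 - 1 = k - 2 by ring] at h₁
  rw [show k - 2 - 1 = k - 3 by ring] at h₂
  push_cast at h₁ h₂
  set s : ℝ := (k : ℝ) + 1 / 2
  linear_combination (n * (n - 1) + s * (n - 1) + s ^ 2) * h₀ -
    (s * (n - 1) + s * (2 * s - 1)) * h₁ + s * (s - 1) * h₂

theorem fiveTermTranspose_halfBinomCoeff_zero (k : ℤ) :
    fiveTermTranspose (halfBinomCoeff 0) k = 0 := by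
  simp only [fiveTermTranspose, halfBinomCoeff_zero]
  ring

theorem fiveTermTranspose_halfBinomCoeff_succ (n : ℕ) (k : ℤ) :
    fiveTermTranspose (halfBinomCoeff (n + 1)) k =
      -((n : ℝ) ^ 2 * (n - 1) * halfBinomCoeff n k) := by
  have h₀ := halfBinomCoeff_succ_add_one n k
  have h₁ := halfBinomCoeff_succ_add_one n (k - 1)
  have h₂ := halfBinomCoeff_succ_add_one n (k - 2)
  have h₃ := halfBinomCoeff_succ_add_one n (k - 3)
  rw [show k - 1 + 1 = k by ring] at h₁
  rw [show k - 2 + 1 = k - 1 by ring] at h₂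
  rw [show k - 3 + 1 = k - 2 by ring] at h₃
  rw [sq_mul_sub_one_mul_halfBinomCoeff, fiveTermTranspose]
  set s : ℝ := (k : ℝ) + 1 / 2
  linear_combination s * (s - 1) / 4 * (s * h₀ - (3 * k - 1 / 2) * h₁ + (3 * k - 5 / 2) * h₂
    - (k - 3 / 2) * h₃)

/-- The coefficient of `z^m` in `∑ₖ a_k^{(g)} (1 - 4z)^{k + 1/2}`, for the solution `a = vCoeff` of
the recursion. -/
noncomputable def vSeriesCoeff (g m : ℕ) : ℝ :=
  ∑' k, vCoeff g k * halfBinomCoeff m k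

theorem vSeriesCoeff_eq_sum (g m : ℕ) :
    vSeriesCoeff g m = ∑ k ∈ Finset.Icc (-3 * (g : ℤ)) g, vCoeff g k * halfBinomCoeff m k :=
  genusSupported_vCoeff.tsum_mul_eq g _

theorem vSeriesCoeff_apply_zero (g : ℕ) : vSeriesCoeff g 0 = if g = 0 then -1 / 2 else 0 := by
  simp only [vSeriesCoeff_eq_sum, halfBinomCoeff_zero, mul_one]
  cases g with
  | zero => simp [vCoeff_zero]
  | succ g => rw [sum_vCoeff_succ, if_neg g.succ_ne_zero]

theorem vSeriesCoeff_apply_succ (g m : ℕ) :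
    ((m : ℝ) + 1) * vSeriesCoeff g (m + 1) = (4 * m - 2) * vSeriesCoeff g m -
      ∑' k : ℤ, 4 * (k : ℝ) * vCoeff g k * halfBinomCoeff m k := by
  have hsummable (f : ℤ → ℝ) := summable_mul_of_finite_support
    (genusSupported_vCoeff.finite_support g) f
  have hassoc (k : ℤ) : 4 * (k : ℝ) * vCoeff g k * halfBinomCoeff m k =
      vCoeff g k * (4 * k * halfBinomCoeff m k) := by ring
  simp only [hassoc, vSeriesCoeff, ← tsum_mul_left]
  rw [← Summable.tsum_sub ((hsummable _).mul_left _) (hsummable _)]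
  exact tsum_congr fun k => by
    linear_combination vCoeff g k * halfBinomCoeff_succ m k

theorem vSeriesCoeff_zero_succ (m : ℕ) :
    ((m : ℝ) + 1) * vSeriesCoeff 0 (m + 1) = (4 * m - 2) * vSeriesCoeff 0 m := by
  have hindex (k : ℤ) : 4 * (k : ℝ) * vCoeff 0 k * halfBinomCoeff m k = 0 := by
    by_cases hk : k = 0 <;> simp [vCoeff_zero, hk]
  simp only [vSeriesCoeff_apply_succ, hindex, tsum_zero, sub_zero]

theorem vSeriesCoeff_succ_succ (g m : ℕ) :
    ((m : ℝ) + 1) * vSeriesCoeff (g + 1) (m + 1) = (4 * m - 2) * vSeriesCoeff (g + 1) m -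
      ∑' k, vCoeff g k * fiveTermTranspose (halfBinomCoeff m) k := by
  rw [vSeriesCoeff_apply_succ, ← tsum_fiveTerm_mul (genusSupported_vCoeff.finite_support g)]
  simp only [index_mul_vCoeff_succ]

theorem vSeriesCoeff_succ_one (g : ℕ) : vSeriesCoeff (g + 1) 1 = 0 := by
  simpa [vSeriesCoeff_apply_zero, fiveTermTranspose_halfBinomCoeff_zero] using
    vSeriesCoeff_succ_succ g 0

theorem vSeriesCoeff_succ_add_two (g n : ℕ) :
    ((n : ℝ) + 2) * vSeriesCoeff (g + 1) (n + 2) = (4 * n + 2) * vSeriesCoeff (g + 1) (n + 1) +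
      (n : ℝ) ^ 2 * (n - 1) * vSeriesCoeff g n := by
  have h := vSeriesCoeff_succ_succ g (n + 1)
  simp only [fiveTermTranspose_halfBinomCoeff_succ, mul_neg, mul_left_comm (vCoeff g _), tsum_neg,
    tsum_mul_left] at h
  rw [← vSeriesCoeff] at h
  push_cast at h
  linear_combination h

theorem vSeriesCoeff_zero_one : vSeriesCoeff 0 1 = 1 := by
  have h := vSeriesCoeff_zero_succ 0
  norm_num [vSeriesCoeff_apply_zero] at h
  exact h

theorem vSeriesCoeff_zero_two : vSeriesCoeff 0 2 = 1 := by
  have h := vSeriesCoeff_zero_succ 1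
  norm_num [vSeriesCoeff_zero_one] at h
  exact h

theorem vSeriesCoeff_succ_two (g : ℕ) : vSeriesCoeff (g + 1) 2 = 0 := by
  simpa [vSeriesCoeff_succ_one] using vSeriesCoeff_succ_add_two g 0

theorem vSeriesCoeff_eq_zero {g m : ℕ} (h : m < 2 * g) : vSeriesCoeff g (m + 1) = 0 := by
  induction m using Nat.strong_induction_on generalizing g with
  | _ m ih =>
    obtain ⟨g, rfl⟩ : ∃ h, g = h + 1 := Nat.exists_eq_add_one.mpr (by lia)
    match m with
    | 0 => exact vSeriesCoeff_succ_one g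
    | 1 => exact vSeriesCoeff_succ_two g
    | p + 2 =>
      have hrec := vSeriesCoeff_succ_add_two g (p + 1)
      rw [ih (p + 1) (by lia) (by lia), ih p (by lia) (by lia), mul_zero, mul_zero,
        add_zero] at hrec
      exact (mul_eq_zero.mp hrec).resolve_left (by positivity)

end SeriesCoefficients

/-! ### The genus expansion -/

section GenusExpansion

/-- The expansion `∑_g x^{1-2g} c_m^{(g)}` of the `m`-th moment, truncated to `g < K`. -/
noncomputable def truncatedMoment (x : ℝ) (K m : ℕ) : ℝ :=
  ∑ g ∈ Finset.range K, x ^ (1 - 2 * (g : ℤ)) * vSeriesCoeff g (m + 1)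

theorem truncatedMoment_succ (x : ℝ) (K m : ℕ) :
    truncatedMoment x (K + 1) m =
      ∑ g ∈ Finset.range K, x ^ (1 - 2 * ((g + 1 : ℕ) : ℤ)) * vSeriesCoeff (g + 1) (m + 1) +
        x * vSeriesCoeff 0 (m + 1) := by
  rw [truncatedMoment, Finset.sum_range_succ', Nat.cast_zero, mul_zero, sub_zero, zpow_one]

theorem truncatedMoment_zero (x : ℝ) (K : ℕ) : truncatedMoment x (K + 1) 0 = x := by
  simp [truncatedMoment_succ, vSeriesCoeff_succ_one, vSeriesCoeff_zero_one]

theorem truncatedMoment_one (x : ℝ) (K : ℕ) : truncatedMoment x (K + 1) 1 = x := by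
  simp [truncatedMoment_succ, vSeriesCoeff_succ_two, vSeriesCoeff_zero_two]

theorem truncatedMoment_add_two {x : ℝ} (hx : x ≠ 0) (K p : ℕ) :
    ((p : ℝ) + 3) * truncatedMoment x (K + 1) (p + 2) =
      (4 * p + 6) * truncatedMoment x (K + 1) (p + 1) +
        p * (p + 1) ^ 2 * (x ^ (-2 : ℤ) * truncatedMoment x K p) := by
  have hzero := vSeriesCoeff_zero_succ (p + 2)
  push_cast at hzero
  have hterm (g : ℕ) :
      (p + 3) * (x ^ (1 - 2 * ((g + 1 : ℕ) : ℤ)) * vSeriesCoeff (g + 1) (p + 2 + 1)) =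
        (4 * p + 6) * (x ^ (1 - 2 * ((g + 1 : ℕ) : ℤ)) * vSeriesCoeff (g + 1) (p + 1 + 1)) +
          p * (p + 1) ^ 2 * (x ^ (-2 : ℤ) * (x ^ (1 - 2 * (g : ℤ)) * vSeriesCoeff g (p + 1))) := by
    have hpow : x ^ (1 - 2 * ((g + 1 : ℕ) : ℤ)) = x ^ (-2 : ℤ) * x ^ (1 - 2 * (g : ℤ)) := by
      rw [← zpow_add₀ hx]
      congr 1
      push_cast
      ring
    have hrec := vSeriesCoeff_succ_add_two g (p + 1)
    push_cast at hrec
    rw [hpow]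
    linear_combination x ^ (-2 : ℤ) * x ^ (1 - 2 * (g : ℤ)) * hrec
  rw [truncatedMoment_succ, truncatedMoment_succ, truncatedMoment, mul_add, Finset.mul_sum,
    Finset.sum_congr rfl fun g _ => hterm g, Finset.sum_add_distrib, ← Finset.mul_sum,
    ← Finset.mul_sum, ← Finset.mul_sum]
  linear_combination x * hzero

theorem laguerreMoment_eq_truncatedMoment {N : ℕ} (hN : 0 < N) {m K : ℕ} (hK : m < 2 * K) :
    laguerreMoment N m = truncatedMoment N K m := by
  induction m using Nat.strong_induction_on generalizing K with
  | _ m ih =>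
    obtain ⟨K, rfl⟩ : ∃ k, K = k + 1 := Nat.exists_eq_add_one.mpr (by lia)
    match m with
    | 0 => rw [laguerreMoment_zero hN, truncatedMoment_zero]
    | 1 => rw [laguerreMoment_one hN, truncatedMoment_one]
    | p + 2 =>
      apply mul_left_cancel₀ (by positivity : (p : ℝ) + 3 ≠ 0)
      rw [laguerreMoment_add_two hN, truncatedMoment_add_two (Nat.cast_ne_zero.mpr hN.ne'),
        ih (p + 1) (by lia) (K := K + 1) (by lia), ih p (by lia) (K := K) (by lia)]

theorem tendsto_sum_zpow_neg_mul (K : ℕ) (c : ℕ → ℝ) :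
    Tendsto (fun x : ℝ => ∑ h ∈ Finset.range (K + 1), x ^ (-(2 * (h : ℤ))) * c h) atTop
      (𝓝 (c 0)) := by
  have hterm (h : ℕ) :
      Tendsto (fun x : ℝ => x ^ (-(2 * ((h + 1 : ℕ) : ℤ))) * c (h + 1)) atTop (𝓝 0) := by
    simpa only [zero_mul] using
      (tendsto_zpow_atTop_zero (𝕜 := ℝ) (by lia : -(2 * ((h + 1 : ℕ) : ℤ)) < 0)).mul_const
        (c (h + 1))
  simpa [Finset.sum_range_succ'] using
    (tendsto_finsetSum (Finset.range K) fun h _ => hterm h).add_const (c 0)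

theorem truncatedMoment_add (x : ℝ) (g K m : ℕ) :
    truncatedMoment x (g + K) m = truncatedMoment x g m +
      ∑ h ∈ Finset.range K, x ^ (1 - 2 * ((g + h : ℕ) : ℤ)) * vSeriesCoeff (g + h) (m + 1) :=
  Finset.sum_range_add _ g K

theorem zpow_mul_truncatedMoment_add_sub {x : ℝ} (hx : x ≠ 0) (g K m : ℕ) :
    x ^ (2 * (g : ℤ) - 1) * (truncatedMoment x (g + K) m - truncatedMoment x g m) =
      ∑ h ∈ Finset.range K, x ^ (-(2 * (h : ℤ))) * vSeriesCoeff (g + h) (m + 1) := by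
  rw [truncatedMoment_add, add_sub_cancel_left, Finset.mul_sum]
  refine Finset.sum_congr rfl fun h _ => ?_
  rw [← mul_assoc, ← zpow_add₀ hx]
  congr 2
  push_cast
  ring

theorem genusCoeff_eq_vSeriesCoeff (m g : ℕ) : genusCoeff m g = vSeriesCoeff g (m + 1) := by
  induction g using Nat.strong_induction_on with
  | _ g ih =>
    rw [genusCoeff]
    apply Tendsto.limUnder_eq
    have hlim := (tendsto_sum_zpow_neg_mul m fun h => vSeriesCoeff (g + h) (m + 1)).comp
      tendsto_natCast_atTop_atTop
    refine hlim.congr' ?_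
    filter_upwards [eventually_gt_atTop 0] with N hN
    have hprevious : ∑ h : Fin g, (N : ℝ) ^ (1 - 2 * ((h : ℕ) : ℤ)) * genusCoeff m h =
        truncatedMoment N g m := by
      rw [truncatedMoment, ← Fin.sum_univ_eq_sum_range]
      exact Finset.sum_congr rfl fun h _ => by rw [ih h h.isLt]
    rw [hprevious, laguerreMoment_eq_truncatedMoment hN (by lia : m < 2 * (g + (m + 1))),
      zpow_mul_truncatedMoment_add_sub (Nat.cast_ne_zero.mpr hN.ne')]
    rfl

theorem laguerreMoment_eq_sum {N : ℕ} (hN : 0 < N) {m K : ℕ} (hK : m < 2 * K) :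
    laguerreMoment N m =
      ∑ g ∈ Finset.range K, (N : ℝ) ^ (1 - 2 * (g : ℤ)) * genusCoeff m g := by
  simp only [laguerreMoment_eq_truncatedMoment hN hK, truncatedMoment, genusCoeff_eq_vSeriesCoeff]

end GenusExpansion

/-! ### The expansion in the uniformising variable -/

section SpectralVariable

theorem hasSum_halfBinomCoeff {x : ℂ} (hx : 4 < ‖x‖) (k : ℤ) :
    HasSum (fun m => (halfBinomCoeff m k : ℂ) / x ^ m) ((1 - 4 / x) ^ ((k : ℂ) + 1 / 2)) := by
  have hnorm : ‖-4 / x‖ < 1 := by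
    rw [norm_div, norm_neg, Complex.norm_ofNat, div_lt_one (by linarith)]
    exact hx
  have hbinom := (Complex.one_add_cpow_hasFPowerSeriesOnBall_zero (a := (k : ℂ) + 1 / 2)).hasSum
    (y := -4 / x) (by simpa [← ofReal_norm] using hnorm)
  rw [zero_add, neg_div, ← sub_eq_add_neg, ← neg_div] at hbinom
  refine hbinom.congr_fun fun m => ?_
  rw [binomialSeries_apply, halfBinomCoeff]
  push_cast [Complex.ofReal_choose]
  simp only [List.ofFn_const, List.prod_replicate, smul_eq_mul, div_pow]
  ring

theorem hasSum_vSeriesCoeff (g : ℕ) {x : ℂ} (hx : 4 < ‖x‖) :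
    HasSum (fun m => (vSeriesCoeff g m : ℂ) / x ^ m)
      (∑ k ∈ Finset.Icc (-3 * (g : ℤ)) g, (vCoeff g k : ℂ) * (1 - 4 / x) ^ ((k : ℂ) + 1 / 2)) := by
  simp only [vSeriesCoeff_eq_sum, Complex.ofReal_sum, Complex.ofReal_mul, Finset.sum_div,
    mul_div_assoc]
  exact hasSum_sum fun k _ => (hasSum_halfBinomCoeff hx k).mul_left _

theorem hasSum_genusMeanTerm (g : ℕ) {x : ℂ} (hx : 4 < ‖x‖) :
    HasSum (genusMeanTerm g x) ((if g = 0 then 1 / 2 else 0) +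
      ∑ k ∈ Finset.Icc (-3 * (g : ℤ)) g, (vCoeff g k : ℂ) * (1 - 4 / x) ^ ((k : ℂ) + 1 / 2)) := by
  have htail := (hasSum_nat_add_iff' 1).mpr (hasSum_vSeriesCoeff g hx)
  have hhead : (vSeriesCoeff g 0 : ℂ) = -(if g = 0 then 1 / 2 else 0) := by
    rw [vSeriesCoeff_apply_zero]
    split_ifs <;> norm_num
  rw [Finset.sum_range_one, pow_zero, div_one, hhead, sub_neg_eq_add, add_comm] at htail
  exact htail.congr_fun fun m => by rw [genusMeanTerm, genusCoeff_eq_vSeriesCoeff]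

theorem add_one_ne_zero_of_one_lt_norm {u : ℂ} (hu : 1 < ‖u‖) : u + 1 ≠ 0 := fun h => by
  rw [eq_neg_of_add_eq_zero_left h, norm_neg, norm_one] at hu
  exact lt_irrefl _ hu

theorem re_sub_one_div_add_one_pos {u : ℂ} (hu : 1 < ‖u‖) : 0 < ((u - 1) / (u + 1)).re := by
  have hdenom := Complex.normSq_pos.mpr (add_one_ne_zero_of_one_lt_norm hu)
  have hnormSq : 1 < Complex.normSq u := by
    rw [Complex.normSq_eq_norm_sq]
    exact one_lt_pow₀ hu two_ne_zero
  rw [Complex.div_re, ← add_div]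
  refine div_pos ?_ hdenom
  rw [Complex.normSq_apply] at hnormSq
  simp only [Complex.sub_re, Complex.add_re, Complex.one_re, Complex.sub_im, Complex.add_im,
    Complex.one_im]
  linarith

theorem one_lt_norm_exp {l : ℂ} (hl : 0 < l.re) : 1 < ‖Complex.exp l‖ := by
  rwa [Complex.norm_exp, Real.one_lt_exp_iff]

theorem spectralX_eq (l : ℂ) : spectralX l = (Complex.exp l + 1) ^ 2 / Complex.exp l := by
  rw [spectralX, Complex.exp_neg]
  field_simp
  ring

theorem one_sub_four_div_spectralX {l : ℂ} (hl : 0 < l.re) :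
    1 - 4 / spectralX l = ((Complex.exp l - 1) / (Complex.exp l + 1)) ^ 2 := by
  have hexp := add_one_ne_zero_of_one_lt_norm (one_lt_norm_exp hl)
  rw [spectralX_eq]
  field_simp
  ring

theorem one_sub_four_div_spectralX_cpow {l : ℂ} (hl : 0 < l.re) (k : ℤ) :
    (1 - 4 / spectralX l) ^ ((k : ℂ) + 1 / 2) = vFun k l := by
  have hre := re_sub_one_div_add_one_pos (one_lt_norm_exp hl)
  rw [one_sub_four_div_spectralX hl, vFun]
  set w := (Complex.exp l - 1) / (Complex.exp l + 1)
  have hw : w ≠ 0 := fun h => hre.ne' (by rw [h, Complex.zero_re])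
  rw [Complex.cpow_add _ _ (pow_ne_zero 2 hw), Complex.cpow_intCast, one_div,
    Complex.sq_cpow_two_inv hre, zpow_add_one₀ hw, zpow_mul, zpow_ofNat]

theorem genusMean_spectralX (g : ℕ) {l : ℂ} (hl : 0 < l.re) (hx : 4 < ‖spectralX l‖) :
    genusMean g (spectralX l) = (if g = 0 then 1 / 2 else 0) +
      ∑ k ∈ Finset.Icc (-3 * (g : ℤ)) g, (vCoeff g k : ℂ) * vFun k l := by
  simp only [genusMean, (hasSum_genusMeanTerm g hx).tsum_eq, one_sub_four_div_spectralX_cpow hl]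

theorem isVExpansion_vCoeff : IsVExpansion vCoeff :=
  ⟨genusSupported_vCoeff, fun g _ hl hx => genusMean_spectralX g hl hx⟩

theorem four_lt_norm_spectralX_ofReal {l : ℝ} (hl : 0 < l) : 4 < ‖spectralX (l : ℂ)‖ := by
  have hexp : 1 < Real.exp l := Real.one_lt_exp_iff.mpr hl
  have hreal : spectralX l = (((Real.exp l + 1) ^ 2 / Real.exp l : ℝ) : ℂ) := by
    rw [spectralX_eq]
    push_cast
    rfl
  rw [hreal, Complex.norm_real, Real.norm_of_nonneg (by positivity), lt_div_iff₀ (by positivity)]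
  nlinarith [sq_pos_of_pos (sub_pos.mpr hexp)]

theorem vFun_ofReal (k : ℤ) (l : ℝ) :
    vFun k l = (((Real.exp l - 1) / (Real.exp l + 1)) ^ (2 * k + 1) : ℝ) := by
  rw [vFun]
  push_cast
  rfl

theorem tendsto_sub_one_div_add_one : Tendsto (fun u : ℝ => (u - 1) / (u + 1)) atTop (𝓝 1) := by
  have hinv : Tendsto (fun u : ℝ => 1 - 2 * (u + 1)⁻¹) atTop (𝓝 1) := by
    simpa using ((tendsto_atTop_add_const_right _ (1 : ℝ) tendsto_id).inv_tendsto_atTop.const_mul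
      2).const_sub 1
  refine hinv.congr' ?_
  filter_upwards [eventually_gt_atTop 0] with u hu
  field_simp
  ring

theorem tendsto_vFun (k : ℤ) : Tendsto (fun l : ℝ => vFun k l) atTop (𝓝 1) := by
  have hzpow := (tendsto_sub_one_div_add_one.comp Real.tendsto_exp_atTop).zpow₀ (2 * k + 1)
    (Or.inl one_ne_zero)
  rw [one_zpow] at hzpow
  simp only [vFun_ofReal]
  exact_mod_cast (Complex.continuous_ofReal.tendsto 1).comp hzpow

theorem tendsto_genusMean (g : ℕ) :
    Tendsto (fun l : ℝ => genusMean g (spectralX (l : ℂ))) atTop (𝓝 0) := by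
  have hlim : Tendsto (fun l : ℝ => (if g = 0 then 1 / 2 else 0 : ℂ) +
      ∑ k ∈ Finset.Icc (-3 * (g : ℤ)) g, (vCoeff g k : ℂ) * vFun k l) atTop
      (𝓝 ((if g = 0 then 1 / 2 else 0) +
        ∑ k ∈ Finset.Icc (-3 * (g : ℤ)) g, (vCoeff g k : ℂ) * 1)) :=
    (tendsto_finsetSum _ fun k _ => (tendsto_vFun k).const_mul _).const_add _
  have hcancel : (if g = 0 then 1 / 2 else 0 : ℂ) +
      ∑ k ∈ Finset.Icc (-3 * (g : ℤ)) g, (vCoeff g k : ℂ) * 1 = 0 := by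
    have hsum := vSeriesCoeff_apply_zero g
    simp only [vSeriesCoeff_eq_sum, halfBinomCoeff_zero, mul_one] at hsum
    simp only [mul_one, ← Complex.ofReal_sum, hsum]
    split_ifs <;> norm_num
  rw [hcancel] at hlim
  refine hlim.congr' ?_
  filter_upwards [eventually_gt_atTop 0] with l hl
  exact (genusMean_spectralX g (by rwa [Complex.ofReal_re])
    (four_lt_norm_spectralX_ofReal hl)).symm

theorem exists_forall_vFun_eq_zpow {w : ℝ} (hw : w ∈ Set.Ioo (0 : ℝ) 1) :
    ∃ l : ℝ, 0 < l ∧ ∀ k, vFun k l = ((w ^ (2 * k + 1) : ℝ) : ℂ) := by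
  have hsub : 0 < 1 - w := sub_pos.mpr hw.2
  have hlt : 1 < (1 + w) / (1 - w) := (one_lt_div hsub).mpr (by linarith [hw.1])
  refine ⟨Real.log ((1 + w) / (1 - w)), Real.log_pos hlt, fun k => ?_⟩
  have hw_eq : ((1 + w) / (1 - w) - 1) / ((1 + w) / (1 - w) + 1) = w := by
    field_simp
    ring
  rw [vFun_ofReal, Real.exp_log (zero_lt_one.trans hlt), hw_eq]

theorem eq_zero_of_sum_mul_zpow_eq_zero {F ι : Type*} [Field F] {S : Set F} (hS : S.Infinite)
    (hS_zero : (0 : F) ∉ S) {s : Finset ι} {e : ι → ℤ} (he : Set.InjOn e s) {d : ι → F}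
    (h : ∀ w ∈ S, ∑ i ∈ s, d i * w ^ e i = 0) {i : ι} (hi : i ∈ s) : d i = 0 := by
  obtain ⟨M, hM⟩ : ∃ M : ℕ, ∀ i ∈ s, 0 ≤ e i + M :=
    ⟨s.sup fun i => (e i).natAbs, fun i hi => by
      have := Finset.le_sup (f := fun i => (e i).natAbs) hi
      lia⟩
  set q : Polynomial F := ∑ i ∈ s, Polynomial.monomial (e i + M).toNat (d i) with hq
  have hroot : S ⊆ {w | q.IsRoot w} := fun w hw => by
    have hw_ne : w ≠ 0 := fun h => hS_zero (h ▸ hw)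
    have heval : q.eval w = (∑ i ∈ s, d i * w ^ e i) * w ^ M := by
      rw [hq, Polynomial.eval_finsetSum, Finset.sum_mul]
      refine Finset.sum_congr rfl fun i hi => ?_
      rw [Polynomial.eval_monomial, ← zpow_natCast, Int.toNat_of_nonneg (hM i hi),
        zpow_add₀ hw_ne, zpow_natCast, mul_assoc]
    rw [Set.mem_ofPred_eq, Polynomial.IsRoot, heval, h w hw, zero_mul]
  have hcoeff : q.coeff (e i + M).toNat = d i := by
    simp only [hq, Polynomial.finsetSum_coeff, Polynomial.coeff_monomial]
    refine (Finset.sum_eq_single_of_mem i hi fun j hj hji => if_neg fun hij => hji ?_).trans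
      (if_pos rfl)
    exact he hj hi (by have := hM i hi; have := hM j hj; lia)
  rw [← hcoeff, Polynomial.eq_zero_of_infinite_isRoot q (hS.mono hroot), Polynomial.coeff_zero]

theorem IsVExpansion.eq {a b : ℕ → ℤ → ℝ} (ha : IsVExpansion a) (hb : IsVExpansion b) :
    a = b := by
  obtain ⟨ha_supp, ha_exp⟩ := ha
  obtain ⟨hb_supp, hb_exp⟩ := hb
  ext g k
  by_cases hk : k ∈ Finset.Icc (-3 * (g : ℤ)) g
  · refine sub_eq_zero.mp (eq_zero_of_sum_mul_zpow_eq_zero (Set.Ioo_infinite (zero_lt_one' ℝ))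
      Set.left_notMem_Ioo (e := fun k => 2 * k + 1) (d := fun k => a g k - b g k)
      (fun i _ j _ hij => by lia) (fun w hw => ?_) hk)
    obtain ⟨l, hl, hv⟩ := exists_forall_vFun_eq_zpow hw
    have hre : 0 < (l : ℂ).re := by rwa [Complex.ofReal_re]
    have hx := four_lt_norm_spectralX_ofReal hl
    have hsum := add_left_cancel ((ha_exp g l hre hx).symm.trans (hb_exp g l hre hx))
    simp only [hv] at hsum
    simp only [sub_mul, Finset.sum_sub_distrib, sub_eq_zero]
    exact_mod_cast hsum
  · rw [Finset.mem_Icc] at hk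
    rw [ha_supp g k (by lia), hb_supp g k (by lia)]

theorem isVExpansion_iff_eq_vCoeff (b : ℕ → ℤ → ℝ) : IsVExpansion b ↔ b = vCoeff :=
  ⟨fun hb => hb.eq isVExpansion_vCoeff, fun hb => hb ▸ isVExpansion_vCoeff⟩

end SpectralVariable

theorem mainTheorem4 :
    -- the genus expansion of the one-loop mean, coefficient by coefficient in `1/x`
    (∀ N m : ℕ, 1 ≤ N →
      laguerreMoment N m =
        ∑ g ∈ Finset.range (m / 2 + 1), (N : ℝ) ^ (1 - 2 * (g : ℤ)) * genusCoeff m g) ∧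
    (∀ g m : ℕ, m < 2 * g → genusCoeff m g = 0) ∧
    -- each genus term is an honest function of `x` for `|x| > 4`
    (∀ (g : ℕ) (x : ℂ), 4 < ‖x‖ → Summable (genusMeanTerm g x)) ∧
    -- the asymptotic condition
    (∀ g : ℕ, Tendsto (fun l : ℝ => genusMean g (spectralX (l : ℂ))) atTop (𝓝 0)) ∧
    -- the coefficients of the expansion in the `v_k` exist, are unique, and are exactly the
    -- solution of the recursion
    (∃ a : ℕ → ℤ → ℝ,
      (∀ b : ℕ → ℤ → ℝ, IsVExpansion b ↔ b = a) ∧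
      (∀ b : ℕ → ℤ → ℝ, SatisfiesVRecursion b ↔ b = a)) := by
  refine ⟨fun N m hN => laguerreMoment_eq_sum hN (by lia), fun g m hm => ?_,
    fun g x hx => (hasSum_genusMeanTerm g hx).summable, tendsto_genusMean,
    vCoeff, isVExpansion_iff_eq_vCoeff, satisfiesVRecursion_iff_eq_vCoeff⟩
  rw [genusCoeff_eq_vSeriesCoeff, vSeriesCoeff_eq_zero hm]
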